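/- Let $n\ge 0$. Let $SPD(n)$ be the manifold of real symmetric positive definite $n\times n$ matrices, an open subset of the space $Sym(n)$ of symmetric matrices. For $A\in SPD(n)$ and $X\in Sym(n)=T_ASPD(n)$ let $\Gamma_A[X]$ be the unique solution $Y$ of $AY+YA=X$, and let $$g_W|_A(X,Y)=\operatorname{tr}(\Gamma_A[Y]\,A\,\Gamma_A[X])=\tfrac12\operatorname{tr}(\Gamma_A[Y]X)$$ be the Wasserstein Riemannian metric. A minimal geodesic from $A_1$ to $A_2$ is a smooth curve $\gamma:[0,1]\to SPD(n)$ from $A_1$ to $A_2$ with $\nabla_{\dot\gamma}\dot\gamma=0$ for the Levi-Civita connection of $g_W$, whose length is the Riemannian distance of $A_1$ and $A_2$ (the infimum of the lengths of $C^1$ curves in $SPD(n)$ joining them). $M^{1/2}$ denotes the principal square root of $M$: the unique $S$ with $S^2=M$ all of whose complex eigenvalues have positive real part. On $GL(n)$ take the Euclidean metric $g_E(X,Y)=\operatorname{tr}(X^TY)$ and the projection $\sigma:GL(n)\to SPD(n)$, $\sigma(\widetilde A)=\widetilde A^T\widetilde A$; a tangent vector $W$ at $\widetilde A$ is horizontal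 if $g_E(W,V)=0$ for all $V$ with $d\sigma_{\widetilde A}(V)=0$. Then $(SPD(n),g_W)$ is geodesically convex, that is, any two points are joined by a minimal geodesic. More precisely, for all $A_1,A_2\in SPD(n)$: 1. The principal square roots $(A_1A_2)^{1/2}$, $(A_2A_1)^{1/2}$ and $A_1^{1/2}$ exist and are unique, and $A_1^{1/2}\in SPD(n)$. 2. The curve $$\gamma(t)=(1-t)^2A_1+t(1-t)\big[(A_1A_2)^{1/2}+(A_2A_1)^{1/2}\big]+t^2A_2,\qquad t\in[0,1],$$ lies in $SPD(n)$ and is a minimal geodesic from $A_1$ to $A_2$. 3. Let $\widetilde A_2=A_1^{-1/2}(A_1A_2)^{1/2}$ and $l(t)=t\widetilde A_2+(1-t)A_1^{1/2}$, $t\in[0,1]$. Then $\sigma(A_1^{1/2})=A_1$, $\sigma(\widetilde A_2)=A_2$, the segment is non-degenerate ($\det l(t)>0$ for all $t\in[0,1]$, so that it stays in $GL(n)$), $\dot l(t)$ is horizontal at $l(t)$ for all $t\in[0,1]$, and $\sigma(l(t))=\gamma(t)$. -/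

import Mathlib

open scoped Manifold ContDiff Bundle

noncomputable section

namespace BuresWasserstein

/-! ### The manifold `SPD(n)` -/

/-- The space `M(n)` of real `n × n` matrices. -/
abbrev Mat (n : ℕ) : Type := Matrix (Fin n) (Fin n) ℝ

/-- The subspace of symmetric matrices. -/
def symSubmodule (n : ℕ) : Submodule ℝ (Mat n) where
  carrier := {X | X.IsSymm}
  add_mem' hX hY := hX.add hY
  zero_mem' := Matrix.isSymm_zero
  smul_mem' c _ hX := hX.smul c

/-- The vector space `Sym(n)` of real symmetric `n × n` matrices. -/
def SymMat (n : ℕ) : Type := symSubmodule n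

/-- `Sym(n)` is normed by the Frobenius norm; the norm is only used for its topology. -/
instance (n : ℕ) : NormedAddCommGroup (SymMat n) :=
  letI := Matrix.frobeniusNormedAddCommGroup (m := Fin n) (n := Fin n) (α := ℝ)
  inferInstanceAs (NormedAddCommGroup (symSubmodule n))

instance (n : ℕ) : NormedSpace ℝ (SymMat n) :=
  letI := Matrix.frobeniusNormedAddCommGroup (m := Fin n) (n := Fin n) (α := ℝ)
  letI := Matrix.frobeniusNormedSpace (m := Fin n) (n := Fin n) (α := ℝ) (R := ℝ)
  inferInstanceAs (NormedSpace ℝ (symSubmodule n))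

/-- The inclusion of `Sym(n)` in `M(n)`. -/
def toMat {n : ℕ} : SymMat n →ₗ[ℝ] Mat n where
  toFun X := X.1
  map_add' _ _ := rfl
  map_smul' _ _ := rfl

theorem toMat_injective {n : ℕ} : Function.Injective (toMat (n := n)) := Subtype.val_injective

instance (n : ℕ) : FiniteDimensional ℝ (SymMat n) := .of_injective toMat toMat_injective

theorem transpose_toMat {n : ℕ} (X : SymMat n) : (toMat X).transpose = toMat X := X.2

theorem conjTranspose_toMat {n : ℕ} (X : SymMat n) : (toMat X).conjTranspose = toMat X :=
  (Matrix.conjTranspose_eq_transpose_of_trivial _).trans X.2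

/-- A symmetric matrix as an element of `Sym(n)`. -/
def ofSymm {n : ℕ} (X : Mat n) (hX : X.IsSymm) : SymMat n := ⟨X, hX⟩

@[simp] theorem toMat_ofSymm {n : ℕ} (X : Mat n) (hX : X.IsSymm) : toMat (ofSymm X hX) = X := rfl

theorem continuous_toMat {n : ℕ} : Continuous (toMat (n := n)) :=
  toMat.continuous_of_finiteDimensional

theorem isOpen_posDef (n : ℕ) : IsOpen {A : SymMat n | (toMat A).PosDef} := by
  have key : {A : SymMat n | (toMat A).PosDef} =
      {A : SymMat n | ∀ x ∈ Metric.sphere (0 : Fin n → ℝ) 1, 0 < x ⬝ᵥ ((toMat A).mulVec x)} := by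
    ext A
    constructor
    · intro hA x hx
      have hx0 : x ≠ 0 := by
        rintro rfl
        simp at hx
      simpa using hA.dotProduct_mulVec_pos hx0
    · intro hA
      refine Matrix.PosDef.of_dotProduct_mulVec_pos (conjTranspose_toMat A) ?_
      intro x hx
      have hn : 0 < ‖x‖ := norm_pos_iff.2 hx
      have h1 := hA (‖x‖⁻¹ • x) (by simp [norm_smul, hn.ne'])
      simp only [Matrix.mulVec_smul, smul_dotProduct, dotProduct_smul, smul_eq_mul] at h1
      have h2 : 0 < ‖x‖⁻¹ := inv_pos.2 hn
      have h3 := (mul_pos_iff_of_pos_left h2).1 h1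
      simpa using (mul_pos_iff_of_pos_left h2).1 h3
  rw [key, isOpen_iff_eventually]
  intro A hA
  refine (isCompact_sphere (0 : Fin n → ℝ) 1).eventually_forall_of_forall_eventually ?_
  intro x hx
  have hc : Continuous fun p : SymMat n × (Fin n → ℝ) => p.2 ⬝ᵥ ((toMat p.1).mulVec p.2) :=
    continuous_snd.dotProduct
      ((continuous_toMat.comp continuous_fst).matrix_mulVec continuous_snd)
  exact hc.continuousAt.eventually (lt_mem_nhds (hA x hx))

/-- The manifold `SPD(n)` of symmetric positive definite matrices, an open subset of `Sym(n)`
(with the manifold structure that Mathlib gives to open subsets of a normed space). -/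
def SPD (n : ℕ) : TopologicalSpace.Opens (SymMat n) :=
  ⟨{A : SymMat n | (toMat A).PosDef}, isOpen_posDef n⟩

/-- The matrix underlying a point of `SPD(n)`. -/
def mat {n : ℕ} (A : SPD n) : Mat n := toMat (A : SymMat n)

theorem mat_posDef {n : ℕ} (A : SPD n) : (mat A).PosDef := A.2

/-! ### The Sylvester equation -/

theorem eq_zero_of_sylvester {n : ℕ} {A X : Mat n} (hA : A.PosDef) (hX : A * X + X * A = 0) :
    X = 0 := by
  have h1 : (X.conjTranspose * A * X).PosSemidef := hA.posSemidef.conjTranspose_mul_mul_same X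
  have h2 : (X * A * X.conjTranspose).PosSemidef := hA.posSemidef.mul_mul_conjTranspose_same X
  have h3 : (X.conjTranspose * A * X).trace + (X * A * X.conjTranspose).trace = 0 := by
    have h4 : (X * A * X.conjTranspose).trace = (X.conjTranspose * (X * A)).trace :=
      Matrix.trace_mul_comm _ _
    rw [h4, Matrix.mul_assoc, ← Matrix.trace_add, ← Matrix.mul_add, hX]
    simp
  have h6 : (X.conjTranspose * A * X).trace = 0 := by
    have := h1.trace_nonneg
    have := h2.trace_nonneg
    linarith
  have h7 := h1.trace_eq_zero_iff.1 h6
  by_contra hne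
  obtain ⟨v, hv⟩ : ∃ v, X.mulVec v ≠ 0 := by
    by_contra hcon
    push Not at hcon
    exact hne (Matrix.ext_iff_mulVec.2 fun v => by simp [hcon v])
  have h8 := hA.dotProduct_mulVec_pos hv
  have h9 : star (X.mulVec v) ⬝ᵥ A.mulVec (X.mulVec v)
      = star v ⬝ᵥ (X.conjTranspose * A * X).mulVec v := by
    rw [Matrix.star_mulVec, ← Matrix.dotProduct_mulVec, Matrix.mulVec_mulVec,
      Matrix.mulVec_mulVec, Matrix.mul_assoc]
  rw [h9, h7] at h8
  simp at h8

/-- The Sylvester operator `Y ↦ A Y + Y A` on `Sym(n)`, linear also in `A`. -/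
def sylvester {n : ℕ} : SymMat n →L[ℝ] SymMat n →L[ℝ] SymMat n :=
  LinearMap.toContinuousBilinearMap <|
    LinearMap.mk₂ ℝ
      (fun A Y : SymMat n => ofSymm (toMat A * toMat Y + toMat Y * toMat A) (by
        rw [Matrix.IsSymm, Matrix.transpose_add, Matrix.transpose_mul, Matrix.transpose_mul,
          transpose_toMat, transpose_toMat, add_comm]))
      (fun A A' Y => toMat_injective (by simp [Matrix.add_mul, Matrix.mul_add]; abel))
      (fun c A Y => toMat_injective (by simp))
      (fun A Y Y' => toMat_injective (by simp [Matrix.add_mul, Matrix.mul_add]; abel))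
      (fun c A Y => toMat_injective (by simp))

theorem toMat_sylvester {n : ℕ} (A Y : SymMat n) :
    toMat (sylvester A Y) = toMat A * toMat Y + toMat Y * toMat A := rfl

/-- `Γ A X` is the solution `Y` of the Sylvester equation `A Y + Y A = X`, defined through the
inverse of the Sylvester operator. For `A` positive definite it is a solution, and the only one in
`M(n)`: see `sylvester_Γ` and `Γ_unique`. -/
def Γ {n : ℕ} (A : SymMat n) : SymMat n →L[ℝ] SymMat n := (sylvester A).inverse

theorem sylvester_isInvertible {n : ℕ} (A : SPD n) :
    (sylvester (A : SymMat n)).IsInvertible := by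
  have hinj : Function.Injective (sylvester (A : SymMat n)) := by
    rw [injective_iff_map_eq_zero]
    intro X hX
    exact toMat_injective ((eq_zero_of_sylvester (mat_posDef A)
      (congrArg toMat hX)).trans (map_zero toMat).symm)
  exact ⟨(LinearEquiv.ofInjectiveEndo (sylvester (A : SymMat n) : SymMat n →ₗ[ℝ] SymMat n)
    hinj).toContinuousLinearEquiv, by ext1; rfl⟩

theorem sylvester_Γ {n : ℕ} (A : SPD n) (X : SymMat n) :
    mat A * toMat (Γ (A : SymMat n) X) + toMat (Γ (A : SymMat n) X) * mat A = toMat X := by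
  obtain ⟨e, he⟩ := sylvester_isInvertible A
  refine congrArg toMat (show sylvester (A : SymMat n) (Γ (A : SymMat n) X) = X from ?_)
  rw [Γ, ← he, ContinuousLinearMap.inverse_equiv]
  simp

theorem Γ_unique {n : ℕ} (A : SPD n) (X : SymMat n) (Y : Mat n)
    (hY : mat A * Y + Y * mat A = toMat X) : Y = toMat (Γ (A : SymMat n) X) := by
  refine sub_eq_zero.1 (eq_zero_of_sylvester (mat_posDef A) ?_)
  rw [Matrix.mul_sub, Matrix.sub_mul, sub_add_sub_comm, hY, sylvester_Γ, sub_self]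

/-! ### The Wasserstein metric -/

/-- The bilinear form `g_W|_A (X, Y) = tr (Γ_A[Y] A Γ_A[X])` on `Sym(n)`. -/
def gW {n : ℕ} (A : SymMat n) : SymMat n →L[ℝ] SymMat n →L[ℝ] ℝ :=
  LinearMap.toContinuousBilinearMap <|
    LinearMap.mk₂ ℝ (fun X Y : SymMat n => (toMat (Γ A Y) * toMat A * toMat (Γ A X)).trace)
      (fun X X' Y => by simp [Matrix.mul_add])
      (fun c X Y => by simp)
      (fun X Y Y' => by simp [Matrix.add_mul])
      (fun c X Y => by simp)

theorem gW_apply {n : ℕ} (A X Y : SymMat n) :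
    gW A X Y = (toMat (Γ A Y) * toMat A * toMat (Γ A X)).trace := rfl

theorem gW_symm {n : ℕ} (A X Y : SymMat n) : gW A X Y = gW A Y X := by
  rw [gW_apply, gW_apply, ← Matrix.trace_transpose, Matrix.transpose_mul, Matrix.transpose_mul,
    transpose_toMat, transpose_toMat, transpose_toMat, Matrix.mul_assoc]

/-- The second expression `g_W|_A (X, Y) = (1/2) tr (Γ_A[Y] X)` for the metric. -/
theorem gW_eq_half_trace {n : ℕ} (A : SPD n) (X Y : SymMat n) :
    gW (A : SymMat n) X Y = 1 / 2 * (toMat (Γ (A : SymMat n) Y) * toMat X).trace := by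
  have h := gW_symm (A : SymMat n) X Y
  have h3 : (toMat (Γ (A : SymMat n) Y) * toMat X).trace
      = gW (A : SymMat n) X Y + gW (A : SymMat n) Y X := by
    conv_lhs => rw [← sylvester_Γ A X]
    rw [gW_apply, gW_apply, Matrix.mul_add, Matrix.trace_add, Matrix.mul_assoc]
    congr 1
    rw [Matrix.trace_mul_comm, Matrix.mul_assoc, Matrix.mul_assoc]
    rfl
  rw [h3, ← h]
  ring

theorem gW_pos {n : ℕ} (A : SPD n) (X : SymMat n) (hX : X ≠ 0) : 0 < gW (A : SymMat n) X X := by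
  set G := toMat (Γ (A : SymMat n) X) with hGdef
  have h1 : G.conjTranspose = G := conjTranspose_toMat _
  have hps : (G.conjTranspose * mat A * G).PosSemidef :=
    (mat_posDef A).posSemidef.conjTranspose_mul_mul_same _
  have hval : gW (A : SymMat n) X X = (G.conjTranspose * mat A * G).trace := by
    rw [h1, gW_apply]
    rfl
  rw [hval]
  refine lt_of_le_of_ne hps.trace_nonneg fun h0 => hX ?_
  have h7 := hps.trace_eq_zero_iff.1 h0.symm
  have hG : G = 0 := by
    by_contra hne
    obtain ⟨v, hv⟩ : ∃ v, G.mulVec v ≠ 0 := by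
      by_contra hcon
      push Not at hcon
      exact hne (Matrix.ext_iff_mulVec.2 fun v => by simp [hcon v])
    have h8 := (mat_posDef A).dotProduct_mulVec_pos hv
    have h9 : star (G.mulVec v) ⬝ᵥ (mat A).mulVec (G.mulVec v)
        = star v ⬝ᵥ (G.conjTranspose * mat A * G).mulVec v := by
      rw [Matrix.star_mulVec, ← Matrix.dotProduct_mulVec, Matrix.mulVec_mulVec,
        Matrix.mulVec_mulVec, Matrix.mul_assoc]
    rw [h9, h7] at h8
    simp at h8
  have h := sylvester_Γ A X
  rw [← hGdef, hG] at h
  exact toMat_injective (by simpa using h.symm)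

theorem contDiffOn_gW (n : ℕ) :
    ContDiffOn ℝ ∞ (gW : SymMat n → SymMat n →L[ℝ] SymMat n →L[ℝ] ℝ) (SPD n : Set (SymMat n)) := by
  have hΓ : ContDiffOn ℝ ∞ (fun A : SymMat n => Γ A) (SPD n : Set (SymMat n)) := by
    intro A hA
    have h := (sylvester_isInvertible ⟨A, hA⟩).contDiffAt_map_inverse (n := ∞)
    exact (h.comp A sylvester.contDiff.contDiffAt).contDiffWithinAt
  rw [contDiffOn_clm_apply]
  intro X
  rw [contDiffOn_clm_apply]
  intro Y
  have hY : ContDiffOn ℝ ∞ (fun A : SymMat n => Γ A Y) (SPD n : Set (SymMat n)) :=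
    hΓ.clm_apply contDiffOn_const
  let L : SymMat n →ₗ[ℝ] ℝ :=
    { toFun := fun P => 1 / 2 * (toMat P * toMat X).trace
      map_add' := fun P P' => by simp [Matrix.add_mul, mul_add]
      map_smul' := fun c P => by simp; ring }
  refine (L.toContinuousLinearMap.contDiff.comp_contDiffOn hY).congr fun A hA => ?_
  exact gW_eq_half_trace ⟨A, hA⟩ X Y

theorem isVonNBounded_of_pos {E : Type*} [NormedAddCommGroup E] [NormedSpace ℝ E]
    [FiniteDimensional ℝ E] (B : E →L[ℝ] E →L[ℝ] ℝ) (hB : ∀ v, v ≠ 0 → 0 < B v v) :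
    Bornology.IsVonNBounded ℝ {v : E | B v v < 1} := by
  have : ProperSpace E := FiniteDimensional.proper ℝ E
  rw [NormedSpace.isVonNBounded_iff]
  rcases (Metric.sphere (0 : E) 1).eq_empty_or_nonempty with h | h
  · refine Bornology.IsBounded.subset (Bornology.isBounded_singleton (x := (0 : E))) fun v _ => ?_
    by_contra hv
    have hv0 : v ≠ 0 := hv
    have : ‖v‖⁻¹ • v ∈ Metric.sphere (0 : E) 1 := by
      simp [norm_smul, (norm_pos_iff.2 hv0).ne']
    rw [h] at this
    exact this
  · have hc : Continuous fun v : E => B v v := B.continuous.clm_apply continuous_id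
    obtain ⟨u, hu, hmin⟩ := (isCompact_sphere (0 : E) 1).exists_isMinOn h hc.continuousOn
    have hu0 : u ≠ 0 := by
      rintro rfl
      simp at hu
    have hcpos := hB u hu0
    refine (Metric.isBounded_closedBall (x := (0 : E)) (r := 1 + (B u u)⁻¹)).subset fun v hv => ?_
    rw [mem_closedBall_zero_iff]
    by_contra! hlt
    have hinv : 0 < (B u u)⁻¹ := inv_pos.2 hcpos
    have hn1 : 1 < ‖v‖ := by linarith
    have hn : 0 < ‖v‖ := by linarith
    have hmem : ‖v‖⁻¹ • v ∈ Metric.sphere (0 : E) 1 := by simp [norm_smul, hn.ne']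
    have h1 : B u u ≤ B (‖v‖⁻¹ • v) (‖v‖⁻¹ • v) := hmin hmem
    have h2 : B (‖v‖⁻¹ • v) (‖v‖⁻¹ • v) = ‖v‖⁻¹ * (‖v‖⁻¹ * B v v) := by simp
    have h3 : B v v < 1 := hv
    rw [h2] at h1
    have h4 : B u u * ‖v‖ * ‖v‖ ≤ B v v := by
      have := mul_le_mul_of_nonneg_right h1 (mul_pos hn hn).le
      calc B u u * ‖v‖ * ‖v‖ = B u u * (‖v‖ * ‖v‖) := by ring
        _ ≤ ‖v‖⁻¹ * (‖v‖⁻¹ * B v v) * (‖v‖ * ‖v‖) := this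
        _ = B v v := by field_simp
    have h5 : 1 < B u u * ‖v‖ := by
      have : B u u * (B u u)⁻¹ < B u u * ‖v‖ := mul_lt_mul_of_pos_left (by linarith) hcpos
      rwa [mul_inv_cancel₀ hcpos.ne'] at this
    nlinarith

theorem contMDiff_metric_of_opens {E : Type*} [NormedAddCommGroup E] [NormedSpace ℝ E]
    (U : TopologicalSpace.Opens E) (g : E → E →L[ℝ] E →L[ℝ] ℝ) (hg : ContDiffOn ℝ ∞ g U)
    (G : ∀ x : U, TangentSpace 𝓘(ℝ, E) x →L[ℝ] TangentSpace 𝓘(ℝ, E) x →L[ℝ] ℝ)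
    (hG : ∀ (x : U) (v w : E),
      (G x : E → TangentSpace 𝓘(ℝ, E) x →L[ℝ] ℝ) v w = g x v w) :
    ContMDiff 𝓘(ℝ, E) (𝓘(ℝ, E).prod 𝓘(ℝ, E →L[ℝ] E →L[ℝ] ℝ)) ∞
      (fun b : U => Bundle.TotalSpace.mk' (E →L[ℝ] E →L[ℝ] ℝ) b (G b)) := by
  intro x
  rw [Bundle.contMDiffAt_section]
  have h1 : ContMDiffAt 𝓘(ℝ, E) 𝓘(ℝ, E →L[ℝ] E →L[ℝ] ℝ) ∞ (fun y : U => g y) x := by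
    have : ContMDiffAt 𝓘(ℝ, E) 𝓘(ℝ, E →L[ℝ] E →L[ℝ] ℝ) ∞ g (x : E) :=
      ((hg x x.2).contDiffAt (U.isOpen.mem_nhds x.2)).contMDiffAt
    exact this.comp x (contMDiff_subtype_val.contMDiffAt)
  refine h1.congr_of_eventuallyEq (Filter.Eventually.of_forall fun y => ?_)
  have hy : y ∈ (chartAt E x).source := by
    simp [TopologicalSpace.Opens.chartAt_eq, chartAt_self_eq]
  have key : (trivializationAt E (TangentSpace 𝓘(ℝ, E)) x).symmL ℝ y
      = ContinuousLinearMap.id ℝ E := by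
    rw [TangentBundle.symmL_trivializationAt_eq_core hy]
    ext v
    exact (tangentBundleCore 𝓘(ℝ, E) U).coordChange_self (achart _ y) y (mem_chart_source E y) v
  have hb : y ∈ (trivializationAt E (TangentSpace 𝓘(ℝ, E)) x).baseSet := by
    rw [TangentBundle.trivializationAt_baseSet]
    exact hy
  have key' : ∀ v : E, (trivializationAt E (TangentSpace 𝓘(ℝ, E)) x).symm y v = v := fun v => by
    refine (Bundle.Trivialization.symmL_apply (R := ℝ) _ hb v).symm.trans ?_
    exact congrArg (fun L : E →L[ℝ] E => L v) key
  ext v w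
  refine (inCoordinates_apply_eq₂ (F₁ := E) (F₂ := E) (F₃ := ℝ) (E₃ := fun _ : U => ℝ)
    (x₀ := x) (x := y) hb hb (Set.mem_univ _)).trans ?_
  rw [key', key']
  refine Eq.trans ?_ (hG y v w)
  exact congrArg (fun L : ℝ →ₗ[ℝ] ℝ => L _) (Bundle.Trivial.linearMapAt_trivialization ℝ U ℝ y)

/-- The Wasserstein metric `g_W`, as a smooth Riemannian metric on the manifold `SPD(n)`. -/
def wassersteinMetric (n : ℕ) :
    Bundle.ContMDiffRiemannianMetric 𝓘(ℝ, SymMat n) ∞ (SymMat n)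
      (fun A : SPD n => TangentSpace 𝓘(ℝ, SymMat n) A) where
  inner A := (gW (A : SymMat n) : SymMat n →L[ℝ] SymMat n →L[ℝ] ℝ)
  symm A X Y := gW_symm (A : SymMat n) X Y
  pos A X hX := gW_pos A X hX
  isVonNBounded A := isVonNBounded_of_pos (gW (A : SymMat n)) (gW_pos A)
  contMDiff := contMDiff_metric_of_opens (SPD n) gW (contDiffOn_gW n) _ fun _ _ _ => rfl

/-- `(SPD(n), g_W)` as a Riemannian manifold. -/
instance (n : ℕ) : Bundle.RiemannianBundle
    (fun A : SPD n => TangentSpace 𝓘(ℝ, SymMat n) A) :=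
  ⟨(wassersteinMetric n).toRiemannianMetric⟩

/-- The norm on the tangent spaces, used by Mathlib's length of curves, is that of `g_W`. -/
theorem norm_tangent {n : ℕ} (A : SPD n) (X : TangentSpace 𝓘(ℝ, SymMat n) A) :
    ‖X‖ = Real.sqrt (gW (A : SymMat n) X X) := by
  rw [norm_eq_sqrt_real_inner]
  rfl

/-! ### Geodesics -/

/-- The Christoffel symbols (of the first kind) of the Levi-Civita connection of `g_W` in the
global chart `SPD(n) ⊆ Sym(n)`: for constant vector fields `X, Y, Z`, the Koszul formula reads
`2 g_W(∇_X Y, Z) = X g_W(Y, Z) + Y g_W(X, Z) - Z g_W(X, Y)`. -/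
def christoffel {n : ℕ} (A X Y Z : SymMat n) : ℝ :=
  (fderiv ℝ gW A X Y Z + fderiv ℝ gW A Y X Z - fderiv ℝ gW A Z X Y) / 2

/-- The velocity of a curve in `SPD(n)` parametrized by `[0, 1]` (one-sided at the endpoints). -/
def velocity {n : ℕ} (γ : ℝ → SPD n) (t : ℝ) : SymMat n :=
  derivWithin (fun s => (γ s : SymMat n)) (Set.Icc 0 1) t

/-- The second derivative of a curve in `SPD(n) ⊆ Sym(n)` parametrized by `[0, 1]`. -/
def acceleration {n : ℕ} (γ : ℝ → SPD n) (t : ℝ) : SymMat n :=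
  derivWithin (velocity γ) (Set.Icc 0 1) t

/-- `γ` restricts to a geodesic `[0, 1] → SPD(n)` of `g_W`: it is smooth and satisfies the geodesic
equation `∇_{γ'} γ' = 0`, tested against every tangent vector `Z`. -/
structure IsGeodesic {n : ℕ} (γ : ℝ → SPD n) : Prop where
  smooth : ContMDiffOn 𝓘(ℝ, ℝ) 𝓘(ℝ, SymMat n) ∞ γ (Set.Icc 0 1)
  equation : ∀ t ∈ Set.Icc (0 : ℝ) 1, ∀ Z : SymMat n,
    gW (γ t : SymMat n) (acceleration γ t) Z
      + christoffel (γ t : SymMat n) (velocity γ t) (velocity γ t) Z = 0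

/-- `γ` restricts to a minimal geodesic `[0, 1] → SPD(n)` from `A` to `B`: a geodesic whose length
is the Riemannian distance of `A` and `B`, i.e. the infimum of the lengths of all `C^1` curves
in `SPD(n)` from `A` to `B`. -/
structure IsMinimalGeodesic {n : ℕ} (A B : SPD n) (γ : ℝ → SPD n) : Prop where
  source : γ 0 = A
  target : γ 1 = B
  isGeodesic : IsGeodesic γ
  length_eq : Manifold.pathELength 𝓘(ℝ, SymMat n) γ 0 1
    = Manifold.riemannianEDist 𝓘(ℝ, SymMat n) A B

/-- `(SPD(n), g_W)` is geodesically convex: any two points are joined by a minimal geodesic. -/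
def GeodesicallyConvex (n : ℕ) : Prop :=
  ∀ A B : SPD n, ∃ γ : ℝ → SPD n, IsMinimalGeodesic A B γ

/-! ### Principal square roots -/

/-- `S` is a principal square root of `M`: `S² = M` and all complex eigenvalues of `S` have
positive real part. -/
def IsPrincipalSqrt {n : ℕ} (M S : Mat n) : Prop :=
  S * S = M ∧ ∀ z ∈ spectrum ℂ (S.map (algebraMap ℝ ℂ)), 0 < z.re

open Classical in
/-- The principal square root `M^{1/2}` (`0` if there is none). -/
def principalSqrt {n : ℕ} (M : Mat n) : Mat n :=
  if h : ∃ S, IsPrincipalSqrt M S then h.choose else 0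

/-! ### The bundle `GL(n) → SPD(n)` -/

/-- The projection `σ(A) = Aᵀ A`. -/
def bundleProj {n : ℕ} (A : Mat n) : Mat n := A.transpose * A

/-- The Euclidean metric `g_E(X, Y) = tr (Xᵀ Y)`. -/
def gE {n : ℕ} (X Y : Mat n) : ℝ := (X.transpose * Y).trace

/-- `W`, a tangent vector of `GL(n)` at `A`, is horizontal: it is `g_E`-orthogonal to the kernel
of `dσ` at `A`. -/
def IsHorizontal {n : ℕ} (A W : Mat n) : Prop :=
  ∀ V : Mat n, fderiv ℝ bundleProj A V = 0 → gE W V = 0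

/-- A curve `c : [0, 1] → GL(n)` is level: its velocity is everywhere horizontal. -/
def IsLevel {n : ℕ} (c : ℝ → Mat n) : Prop :=
  ∀ t ∈ Set.Icc (0 : ℝ) 1, IsHorizontal (c t) (derivWithin c (Set.Icc 0 1) t)

/-- The differential of `σ` is `dσ_A(V) = Vᵀ A + Aᵀ V`. -/
theorem fderiv_bundleProj {n : ℕ} (A V : Mat n) :
    fderiv ℝ bundleProj A V = V.transpose * A + A.transpose * V := by
  let _ := Matrix.frobeniusNormedRing (m := Fin n) (α := ℝ)
  let _ := Matrix.frobeniusNormedAlgebra (m := Fin n) (α := ℝ) (R := ℝ)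
  let T : Mat n →L[ℝ] Mat n := LinearMap.toContinuousLinearMap
    ((Matrix.transposeLinearEquiv (Fin n) (Fin n) ℝ ℝ : Mat n ≃ₗ[ℝ] Mat n) : Mat n →ₗ[ℝ] Mat n)
  have h := (T.hasFDerivAt (x := A)).mul' (hasFDerivAt_id A)
  have h2 := congrArg (fun L : Mat n →L[ℝ] Mat n => L V) h.fderiv
  refine Eq.trans ?_ (h2.trans ?_)
  · rfl
  · change A.transpose * V + V.transpose * A = _
    rw [add_comm]

/-! ### The explicit curves -/

/-- The curve `(1-t)² A₁ + t(1-t) [(A₁A₂)^{1/2} + (A₂A₁)^{1/2}] + t² A₂`. -/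
def wassersteinCurve {n : ℕ} (A₁ A₂ : Mat n) (t : ℝ) : Mat n :=
  (1 - t) ^ 2 • A₁ + (t * (1 - t)) • (principalSqrt (A₁ * A₂) + principalSqrt (A₂ * A₁))
    + t ^ 2 • A₂

/-- The lift `A₁^{-1/2} (A₁A₂)^{1/2}` of `A₂`. -/
def liftTarget {n : ℕ} (A₁ A₂ : Mat n) : Mat n :=
  (principalSqrt A₁)⁻¹ * principalSqrt (A₁ * A₂)

/-- The line segment from `A₁^{1/2}` to `A₁^{-1/2} (A₁A₂)^{1/2}`. -/
def liftSegment {n : ℕ} (A₁ A₂ : Mat n) (t : ℝ) : Mat n :=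
  t • liftTarget A₁ A₂ + (1 - t) • principalSqrt A₁

end BuresWasserstein

end

open BuresWasserstein

namespace BuresWasserstein

open Matrix

/-! ### Existence and uniqueness of principal square roots -/

/-! Put `P = A₁^{1/2}` and `Q = (P A₂ P)^{1/2}`, both positive definite. Then `A₁A₂ = P Q² P⁻¹`, so
its principal root is `P Q P⁻¹`, the lift of `A₂` is `Q P⁻¹`, and the segment upstairs is `L(t) =
(tQ + (1-t)P²) P⁻¹`, a product of two positive definite matrices. Its direction `W = Q P⁻¹ - P`
makes `W Pᵀ = Q - P²` symmetric, which is all that the geometry needs: then `W L(t)ᵀ` is symmetric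
for every `t`, `W` is horizontal along the segment, and the potential `G(t) = L(t)⁻¹ W` is symmetric
wherever `L(t)` is invertible.

For `A = LᵀL` one has `A G = LᵀW` and `G A = WᵀL`, so `G = Γ_A[γ']`, while `G A G = WᵀW` is half of
the constant acceleration. The metric has derivative `-tr(Γ[Y] Γ[X] H)` in direction `H`
(`fderiv_gW`), which turns the geodesic equation into `γ'' = 2 G A G` (`geodesic_equation_of_eq`);
the projected segment satisfies it, with constant squared speed `tr(WᵀW)`.

Minimality is a calibration argument, the matrix form of Kantorovich duality. The potential solves
the Riccati (Hamilton-Jacobi) equation `G' = -G²`. For a competitor `c` and a change of time `σ`,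
differentiate `tr(c(t) G(σ(t)))` and bound the result by Young's inequality (`trace_mul_le_of_pos`).
The endpoint values differ by exactly `tr(WᵀW)`, and choosing `σ` proportional to arc length bounds
this by the squared length of `c` (`trace_bundleProj_le_sq_integral`). -/

theorem aeval_mul_comm_of_mul_eq {R : Type*} [Ring R] [Algebra ℂ R] {a b x : R}
    (h : a * x = x * b) (p : Polynomial ℂ) :
    Polynomial.aeval a p * x = x * Polynomial.aeval b p := by
  induction p using Polynomial.induction_on' with
  | add p q hp hq => simp [add_mul, mul_add, hp, hq]
  | monomial k c =>
    have hk : a ^ k * x = x * b ^ k := (SemiconjBy.pow_right (a := x) (x := b) (y := a) h.symm k).symm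
    rw [Polynomial.aeval_monomial, Polynomial.aeval_monomial, mul_assoc, hk, ← mul_assoc,
      ← mul_assoc, Algebra.commutes]

/-- The homogeneous Sylvester equation `a x = x b` has only the trivial solution if the spectra of
`a` and `b` are disjoint. -/
theorem eq_zero_of_mul_eq_mul_of_disjoint_spectrum {ι : Type*} [Fintype ι] [DecidableEq ι]
    {a b x : Matrix ι ι ℂ} (h : a * x = x * b) (hd : Disjoint (spectrum ℂ a) (spectrum ℂ b)) :
    x = 0 := by
  -- Cayley-Hamilton kills the side of `a`, leaving `x χ_a(b) = 0`; the roots of `χ_a` avoid the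
  -- spectrum of `b`, so `χ_a(b)` is invertible.
  have h1 := aeval_mul_comm_of_mul_eq h a.charpoly
  rw [Matrix.aeval_self_charpoly, zero_mul] at h1
  have hu : IsUnit (Polynomial.aeval b a.charpoly) := by
    by_contra hu
    rw [(IsAlgClosed.splits a.charpoly).eq_prod_roots, a.charpoly_monic.leadingCoeff,
      Polynomial.C_1, one_mul] at hu
    obtain ⟨k, hk, hk0⟩ := spectrum.exists_mem_of_not_isUnit_aeval_prod hu
    exact Set.disjoint_left.1 hd (Matrix.mem_spectrum_iff_isRoot_charpoly.2 hk0) hk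
  exact (hu.mul_left_eq_zero).1 h1.symm

theorem IsPrincipalSqrt.unique {n : ℕ} {M S T : Mat n} (hS : IsPrincipalSqrt M S)
    (hT : IsPrincipalSqrt M T) : S = T := by
  have hinj : Function.Injective (fun X : Mat n => X.map (algebraMap ℝ ℂ)) :=
    Matrix.map_injective (algebraMap ℝ ℂ).injective
  -- Since `S² = T²`, the difference intertwines `S` with `-T`, whose spectra lie in opposite open
  -- half-planes.
  have h1 : S * (S - T) = (S - T) * -T := by
    rw [mul_sub, sub_mul, mul_neg, mul_neg, hS.1, hT.1]
    abel
  have h2 : S.map (algebraMap ℝ ℂ) * (S - T).map (algebraMap ℝ ℂ)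
      = (S - T).map (algebraMap ℝ ℂ) * -(T.map (algebraMap ℝ ℂ)) := by
    have h3 := congrArg (fun X : Mat n => (algebraMap ℝ ℂ).mapMatrix X) h1
    simpa only [map_mul, map_neg, RingHom.mapMatrix_apply] using h3
  have h4 := eq_zero_of_mul_eq_mul_of_disjoint_spectrum h2 (by
    refine Set.disjoint_left.2 fun z hz hz' => ?_
    rw [← spectrum.neg_eq, Set.mem_neg] at hz'
    have := hS.2 z hz
    have := hT.2 _ hz'
    rw [Complex.neg_re] at this
    linarith)
  exact sub_eq_zero.1 (hinj (h4.trans (by simp)))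

theorem principalSqrt_eq {n : ℕ} {M S : Mat n} (hS : IsPrincipalSqrt M S) :
    principalSqrt M = S := by
  have h : ∃ S, IsPrincipalSqrt M S := ⟨S, hS⟩
  rw [principalSqrt, dif_pos h]
  exact h.choose_spec.unique hS

open scoped MatrixOrder in
theorem exists_posDef_sqrt {n : ℕ} {A : Mat n} (hA : A.PosDef) :
    ∃ P : Mat n, P.PosDef ∧ P * P = A := by
  have hP : (CFC.sqrt A).PosSemidef := (CFC.sqrt_nonneg A).posSemidef
  have hPA : CFC.sqrt A * CFC.sqrt A = A := CFC.sqrt_mul_sqrt_self A hA.posSemidef.nonneg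
  refine ⟨CFC.sqrt A, hP.posDef_iff_isUnit.2 ?_, hPA⟩
  have hu := hA.isUnit
  rw [← hPA] at hu
  exact isUnit_of_mul_isUnit_left hu

theorem transpose_eq_of_posDef {n : ℕ} {P : Mat n} (hP : P.PosDef) : P.transpose = P :=
  (Matrix.conjTranspose_eq_transpose_of_trivial _).symm.trans hP.isHermitian

-- Writing `Q = P²` with `P` real symmetric and invertible exhibits the complexification of `Q` as
-- `PᴴP`, hence as a complex positive definite matrix with positive eigenvalues.
open scoped ComplexOrder in
theorem re_pos_of_mem_spectrum_of_posDef {n : ℕ} {Q : Mat n} (hQ : Q.PosDef) :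
    ∀ z ∈ spectrum ℂ (Q.map (algebraMap ℝ ℂ)), 0 < z.re := by
  obtain ⟨P, hP, rfl⟩ := exists_posDef_sqrt hQ
  have hu : IsUnit (P.map (algebraMap ℝ ℂ)) := hP.isUnit.map (algebraMap ℝ ℂ).mapMatrix
  have hPt : (P.map (algebraMap ℝ ℂ)).conjTranspose = P.map (algebraMap ℝ ℂ) := by
    conv_rhs => rw [← transpose_eq_of_posDef hP]
    ext i j
    simp
  have hpd : ((P * P).map (algebraMap ℝ ℂ)).PosDef := by
    have := Matrix.PosDef.conjTranspose_mul_self (P.map (algebraMap ℝ ℂ))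
      (Matrix.mulVec_injective_iff_isUnit.2 hu)
    rwa [hPt, ← Matrix.map_mul] at this
  intro z hz
  rw [hpd.isHermitian.spectrum_eq_image_range] at hz
  obtain ⟨_, ⟨i, rfl⟩, rfl⟩ := hz
  simpa using hpd.eigenvalues_pos i

theorem isPrincipalSqrt_of_posDef {n : ℕ} {P : Mat n} (hP : P.PosDef) :
    IsPrincipalSqrt (P * P) P :=
  ⟨rfl, re_pos_of_mem_spectrum_of_posDef hP⟩

theorem IsPrincipalSqrt.transpose {n : ℕ} {M S : Mat n} (h : IsPrincipalSqrt M S) :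
    IsPrincipalSqrt M.transpose S.transpose := by
  refine ⟨by rw [← Matrix.transpose_mul, h.1], fun z hz => h.2 z ?_⟩
  rw [Matrix.transpose_map, Matrix.mem_spectrum_iff_isRoot_charpoly,
    Matrix.charpoly_transpose] at hz
  exact Matrix.mem_spectrum_iff_isRoot_charpoly.2 hz

/-- Conjugation respects squares and preserves the spectrum. This gives a root of the product
`A₁A₂`, which need not be symmetric. -/
theorem isPrincipalSqrt_conj {n : ℕ} {P Q : Mat n} (hP : IsUnit P) (hQ : Q.PosDef) :
    IsPrincipalSqrt (P * (Q * Q) * P⁻¹) (P * Q * P⁻¹) := by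
  have hP' := (Matrix.isUnit_iff_isUnit_det _).1 hP
  refine ⟨?_, ?_⟩
  · simp only [Matrix.mul_assoc, Matrix.nonsing_inv_mul_cancel_left _ _ hP']
  · intro z hz
    refine re_pos_of_mem_spectrum_of_posDef hQ z ?_
    obtain ⟨u, rfl⟩ := hP
    let v : (Matrix (Fin n) (Fin n) ℂ)ˣ := Units.map (algebraMap ℝ ℂ).mapMatrix.toMonoidHom u
    rw [← spectrum.units_conjugate (u := v)]
    convert hz using 2
    have : (↑(v⁻¹) : Matrix (Fin n) (Fin n) ℂ) = ((u : Mat n)⁻¹).map (algebraMap ℝ ℂ) := by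
      rw [← Matrix.coe_units_inv]
      rfl
    rw [this, Matrix.map_mul, Matrix.map_mul]
    rfl

/-! ### The segment upstairs, in terms of positive definite square roots -/

/-- `P = A₁^{1/2}` and `Q = (P A₂ P)^{1/2}`. -/
theorem exists_square_roots {n : ℕ} {A₁ A₂ : Mat n} (h₁ : A₁.PosDef) (h₂ : A₂.PosDef) :
    ∃ P Q : Mat n, P.PosDef ∧ Q.PosDef ∧ P * P = A₁ ∧ P⁻¹ * (Q * Q) * P⁻¹ = A₂ := by
  obtain ⟨P, hP, hPA⟩ := exists_posDef_sqrt h₁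
  have hpd : (P * A₂ * P).PosDef := by
    have := h₂.conjTranspose_mul_mul_same (B := P) (Matrix.mulVec_injective_iff_isUnit.2 hP.isUnit)
    rwa [show P.conjTranspose = P from hP.isHermitian] at this
  obtain ⟨Q, hQ, hQA⟩ := exists_posDef_sqrt hpd
  have hP' := (Matrix.isUnit_iff_isUnit_det _).1 hP.isUnit
  refine ⟨P, Q, hP, hQ, hPA, ?_⟩
  rw [hQA]
  simp only [Matrix.mul_assoc, Matrix.nonsing_inv_mul_cancel_left _ _ hP',
    Matrix.mul_nonsing_inv _ hP', Matrix.mul_one]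

/-! ### The first derivative of the metric and the geodesic equation -/

theorem Γ_sylvester {n : ℕ} (A : SPD n) (U : SymMat n) :
    Γ (A : SymMat n) (sylvester (A : SymMat n) U) = U :=
  toMat_injective (Γ_unique A _ _ rfl).symm

theorem sylvester_Γ_eq {n : ℕ} (A : SPD n) (X : SymMat n) :
    sylvester (A : SymMat n) (Γ (A : SymMat n) X) = X :=
  toMat_injective (sylvester_Γ A X)

/-- With potentials `U`, `V` held fixed, `g_B(BU + UB, BV + VB) = tr(V B U)` is linear in `B`.
Differentiating this identity at `A` by the product rule isolates the derivative of the metric and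
avoids differentiating `Γ`. -/
theorem fderiv_gW {n : ℕ} (A : SPD n) (H X Y : SymMat n) :
    fderiv ℝ gW (A : SymMat n) H X Y
      = -(toMat (Γ (A : SymMat n) Y) * toMat (Γ (A : SymMat n) X) * toMat H).trace := by
  obtain ⟨U, rfl⟩ : ∃ U, sylvester (A : SymMat n) U = X := ⟨_, sylvester_Γ_eq A X⟩
  obtain ⟨V, rfl⟩ : ∃ V, sylvester (A : SymMat n) V = Y := ⟨_, sylvester_Γ_eq A Y⟩
  have hA : (SPD n : Set (SymMat n)) ∈ nhds (A : SymMat n) := (SPD n).isOpen.mem_nhds A.2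
  have hg :=
    (((contDiffOn_gW n).contDiffAt hA).differentiableAt (by simp)).hasFDerivAt
  have hU : HasFDerivAt (fun B : SymMat n => sylvester B U) (sylvester.flip U) (A : SymMat n) :=
    (sylvester.flip U).hasFDerivAt
  have hV : HasFDerivAt (fun B : SymMat n => sylvester B V) (sylvester.flip V) (A : SymMat n) :=
    (sylvester.flip V).hasFDerivAt
  have h1 := (hg.clm_apply hU).clm_apply hV
  let L : SymMat n →ₗ[ℝ] ℝ :=
    { toFun := fun B => (toMat V * toMat B * toMat U).trace
      map_add' := fun B B' => by simp [Matrix.mul_add, Matrix.add_mul]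
      map_smul' := fun c B => by simp }
  have h2 : HasFDerivAt (fun B : SymMat n => gW B (sylvester B U) (sylvester B V))
      L.toContinuousLinearMap (A : SymMat n) := by
    refine L.toContinuousLinearMap.hasFDerivAt.congr_of_eventuallyEq ?_
    filter_upwards [hA] with B hB
    rw [gW_apply, Γ_sylvester ⟨B, hB⟩, Γ_sylvester ⟨B, hB⟩]
    rfl
  have h3 := congrArg (fun T : SymMat n →L[ℝ] ℝ => T H) (h1.unique h2)
  have h4 : fderiv ℝ gW (A : SymMat n) H (sylvester (A : SymMat n) U) (sylvester (A : SymMat n) V)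
      + gW (A : SymMat n) (sylvester H U) (sylvester (A : SymMat n) V)
      + gW (A : SymMat n) (sylvester (A : SymMat n) U) (sylvester H V)
      = (toMat V * toMat H * toMat U).trace := by
    refine Eq.trans ?_ h3
    simp
    ring
  rw [gW_symm _ _ (sylvester H V), gW_eq_half_trace, gW_eq_half_trace, Γ_sylvester, Γ_sylvester,
    toMat_sylvester, toMat_sylvester] at h4
  rw [Γ_sylvester, Γ_sylvester]
  have e1 : (toMat U * (toMat H * toMat V)).trace = (toMat V * toMat U * toMat H).trace := by
    rw [← Matrix.mul_assoc, Matrix.trace_mul_comm, Matrix.mul_assoc]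
  have e2 : (toMat U * (toMat V * toMat H)).trace = (toMat V * toMat H * toMat U).trace :=
    Matrix.trace_mul_comm _ _
  simp only [Matrix.mul_add, Matrix.trace_add, e1, e2] at h4
  simp only [← Matrix.mul_assoc] at h4
  linarith

/-- The geodesic equation in terms of the potential `G = Γ_A[γ']`: it says `γ'' = 2 G A G`. -/
theorem geodesic_equation_of_eq {n : ℕ} (A : SPD n) (X C Z : SymMat n)
    (hC : toMat C = (2 : ℝ) • (toMat (Γ (A : SymMat n) X) * mat A * toMat (Γ (A : SymMat n) X))) :
    gW (A : SymMat n) C Z + christoffel (A : SymMat n) X X Z = 0 := by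
  rw [christoffel, fderiv_gW, fderiv_gW, gW_eq_half_trace, hC]
  have hX := sylvester_Γ A X
  have hZ := sylvester_Γ A Z
  set G := toMat (Γ (A : SymMat n) X) with hG
  set K := toMat (Γ (A : SymMat n) Z) with hK
  rw [← hX, ← hZ]
  -- Cyclicity and transposition leave only `tr(K G G A)` and `tr(K G A G)`. The former cancels
  -- within the Christoffel term, the latter against the acceleration.
  have e1 : (G * G * (mat A * K)).trace = (K * G * (G * mat A)).trace := by
    rw [← Matrix.mul_assoc, Matrix.trace_mul_comm]
    simp only [Matrix.mul_assoc]
  have e2 : (G * G * (K * mat A)).trace = (K * G * (G * mat A)).trace := by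
    rw [← e1, ← Matrix.trace_transpose]
    simp only [Matrix.transpose_mul, hG, hK, transpose_toMat,
      transpose_eq_of_posDef (mat_posDef A)]
    rw [Matrix.trace_mul_comm]
  have e3 : (K * (G * mat A * G)).trace = (K * G * (mat A * G)).trace := by
    simp only [Matrix.mul_assoc]
  simp only [Matrix.mul_add, Matrix.trace_add, Matrix.mul_smul, Matrix.trace_smul, smul_eq_mul,
    e1, e2, e3]
  ring

/-! ### Horizontal segments -/

/-- The segment `L₀ + t W` in `M(n)`. -/
def segmentAt {n : ℕ} (L₀ W : Mat n) (t : ℝ) : Mat n := L₀ + t • W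

/-- The potential `L(t)⁻¹ W` of a segment `L(t) = L₀ + t W`. -/
noncomputable def segmentPotential {n : ℕ} (L₀ W : Mat n) (t : ℝ) : Mat n := (segmentAt L₀ W t)⁻¹ * W

theorem mul_segmentPotential {n : ℕ} {L₀ W : Mat n} {t : ℝ} (hdet : (segmentAt L₀ W t).det ≠ 0) :
    segmentAt L₀ W t * segmentPotential L₀ W t = W :=
  Matrix.mul_nonsing_inv_cancel_left _ _ (isUnit_iff_ne_zero.2 hdet)

/-- The change along the segment is `t W Wᵀ`, itself symmetric, so symmetry at the start propagates
to all times. -/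
theorem isSymm_mul_segmentAt_transpose {n : ℕ} {L₀ W : Mat n} (hW : (W * L₀.transpose).IsSymm)
    (t : ℝ) : (W * (segmentAt L₀ W t).transpose).IsSymm := by
  rw [segmentAt, Matrix.transpose_add, Matrix.mul_add, Matrix.transpose_smul, Matrix.mul_smul]
  exact hW.add ((Matrix.isSymm_mul_transpose_self W).smul t)

theorem isSymm_segmentPotential {n : ℕ} {L₀ W : Mat n} (hW : (W * L₀.transpose).IsSymm) {t : ℝ}
    (hdet : (segmentAt L₀ W t).det ≠ 0) : (segmentPotential L₀ W t).IsSymm := by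
  have h := isSymm_mul_segmentAt_transpose hW t
  rw [Matrix.IsSymm, Matrix.transpose_mul, Matrix.transpose_transpose] at h
  have hu := isUnit_iff_ne_zero.2 hdet
  have hu' : IsUnit (segmentAt L₀ W t).transpose.det := by rwa [Matrix.det_transpose]
  rw [segmentPotential, Matrix.IsSymm, Matrix.transpose_mul, Matrix.transpose_nonsing_inv]
  -- `L⁻¹ W = L⁻¹ (W Lᵀ) L⁻ᵀ` is congruent to a symmetric matrix.
  have h2 : (segmentAt L₀ W t)⁻¹ * (segmentAt L₀ W t * W.transpose)
      * ((segmentAt L₀ W t).transpose)⁻¹ = (segmentAt L₀ W t)⁻¹ *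
      (W * (segmentAt L₀ W t).transpose) * ((segmentAt L₀ W t).transpose)⁻¹ := by rw [h]
  rwa [Matrix.nonsing_inv_mul_cancel_left _ _ hu, ← Matrix.mul_assoc,
    Matrix.mul_nonsing_inv_cancel_right _ _ hu'] at h2

/-- Vertical vectors are `V = ΩA` with `Ω` antisymmetric, and `tr(WᵀV)` becomes the pairing of the
symmetric matrix `W Aᵀ` with `Ω`, which vanishes. -/
theorem isHorizontal_of_isSymm {n : ℕ} {A W : Mat n} (hA : A.det ≠ 0)
    (hW : (W * A.transpose).IsSymm) : IsHorizontal A W := by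
  intro V hV
  rw [fderiv_bundleProj] at hV
  have hu := isUnit_iff_ne_zero.2 hA
  have hu' : IsUnit A.transpose.det := by rwa [Matrix.det_transpose]
  have hV1 : A.transpose * V = -(V.transpose * A) := eq_neg_of_add_eq_zero_right hV
  have hΩ : (V * A⁻¹).transpose = -(V * A⁻¹) := by
    rw [Matrix.transpose_mul, Matrix.transpose_nonsing_inv]
    have h2 : (A.transpose)⁻¹ * (A.transpose * V) * A⁻¹
        = (A.transpose)⁻¹ * (-(V.transpose * A)) * A⁻¹ := by rw [hV1]
    rw [Matrix.nonsing_inv_mul_cancel_left _ _ hu', Matrix.mul_neg, Matrix.neg_mul,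
      ← Matrix.mul_assoc, Matrix.mul_nonsing_inv_cancel_right _ _ hu] at h2
    rw [h2, neg_neg]
  have hgE : gE W V = (W * A.transpose * (V * A⁻¹)).trace := by
    rw [← hW, Matrix.transpose_mul, Matrix.transpose_transpose, Matrix.mul_assoc,
      Matrix.trace_mul_comm, gE, ← Matrix.mul_assoc, Matrix.nonsing_inv_mul_cancel_right _ _ hu]
  have h3 : (W * A.transpose * (V * A⁻¹)).trace = -(W * A.transpose * (V * A⁻¹)).trace := by
    conv_lhs => rw [← Matrix.trace_transpose, Matrix.transpose_mul, hΩ, hW, Matrix.neg_mul,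
      Matrix.trace_neg, Matrix.trace_mul_comm]
  rw [hgE]
  linarith

theorem posDef_bundleProj {n : ℕ} {A : Mat n} (hA : A.det ≠ 0) : (bundleProj A).PosDef :=
  Matrix.PosDef.conjTranspose_mul_self A (Matrix.mulVec_injective_iff_isUnit.2
    ((Matrix.isUnit_iff_isUnit_det A).2 (isUnit_iff_ne_zero.2 hA)))

theorem isSymm_bundleProj {n : ℕ} (A : Mat n) : (bundleProj A).IsSymm :=
  Matrix.isSymm_transpose_mul_self A

/-- The projected segment, as a curve in `Sym(n)`. -/
def projectedSegment {n : ℕ} (L₀ W : Mat n) (t : ℝ) : SymMat n :=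
  ofSymm (bundleProj (segmentAt L₀ W t)) (isSymm_bundleProj _)

theorem isSymm_transpose_mul_add {n : ℕ} (L W : Mat n) :
    (L.transpose * W + W.transpose * L).IsSymm := by
  rw [Matrix.IsSymm, Matrix.transpose_add, Matrix.transpose_mul, Matrix.transpose_mul,
    Matrix.transpose_transpose, Matrix.transpose_transpose, add_comm]

/-- The velocity of the projected segment. -/
def projectedVelocity {n : ℕ} (L₀ W : Mat n) (t : ℝ) : SymMat n :=
  ofSymm ((segmentAt L₀ W t).transpose * W + W.transpose * segmentAt L₀ W t)
    (isSymm_transpose_mul_add _ _)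

theorem projectedVelocity_eq {n : ℕ} (L₀ W : Mat n) (t : ℝ) :
    projectedVelocity L₀ W t = projectedVelocity L₀ W 0
      + t • (2 : ℝ) • ofSymm (bundleProj W) (isSymm_bundleProj W) := by
  apply toMat_injective
  simp only [projectedVelocity, segmentAt, bundleProj, toMat_ofSymm, map_add, map_smul,
    Matrix.transpose_add, Matrix.transpose_smul, Matrix.add_mul, Matrix.mul_add, Matrix.mul_smul,
    Matrix.smul_mul, zero_smul, add_zero]
  module

/-- The projection is quadratic in time with coefficients in `Sym(n)`, so its derivatives can be
computed there. -/
theorem projectedSegment_eq {n : ℕ} (L₀ W : Mat n) (t : ℝ) :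
    projectedSegment L₀ W t = projectedSegment L₀ W 0 + t • projectedVelocity L₀ W 0
      + t ^ 2 • ofSymm (bundleProj W) (isSymm_bundleProj W) := by
  apply toMat_injective
  simp only [projectedSegment, projectedVelocity, segmentAt, bundleProj, toMat_ofSymm, map_add,
    map_smul, Matrix.transpose_add, Matrix.transpose_smul, Matrix.add_mul, Matrix.mul_add,
    Matrix.mul_smul, Matrix.smul_mul, zero_smul, add_zero]
  module

theorem hasDerivAt_projectedVelocity {n : ℕ} (L₀ W : Mat n) (t : ℝ) :
    HasDerivAt (projectedVelocity L₀ W)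
      ((2 : ℝ) • ofSymm (bundleProj W) (isSymm_bundleProj W)) t := by
  rw [funext (projectedVelocity_eq L₀ W)]
  simpa using ((hasDerivAt_id t).smul_const
    ((2 : ℝ) • ofSymm (bundleProj W) (isSymm_bundleProj W))).const_add (projectedVelocity L₀ W 0)

theorem hasDerivAt_projectedSegment {n : ℕ} (L₀ W : Mat n) (t : ℝ) :
    HasDerivAt (projectedSegment L₀ W) (projectedVelocity L₀ W t) t := by
  rw [funext (projectedSegment_eq L₀ W), projectedVelocity_eq L₀ W t]
  have h := (((hasDerivAt_id t).smul_const (projectedVelocity L₀ W 0)).const_add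
    (projectedSegment L₀ W 0)).add (((hasDerivAt_id t).pow 2).smul_const
      (ofSymm (bundleProj W) (isSymm_bundleProj W)))
  refine h.congr_deriv ?_
  simp [smul_smul, mul_comm]

theorem contDiff_projectedSegment {n : ℕ} (L₀ W : Mat n) :
    ContDiff ℝ ∞ (projectedSegment L₀ W) := by
  rw [funext (projectedSegment_eq L₀ W)]
  fun_prop

/-- The potential of the segment solves the Sylvester equation for the velocity of its
projection. -/
theorem segmentPotential_eq_Γ {n : ℕ} {L₀ W : Mat n} (hW : (W * L₀.transpose).IsSymm) {t : ℝ}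
    (hdet : (segmentAt L₀ W t).det ≠ 0) (A : SPD n) (hA : mat A = bundleProj (segmentAt L₀ W t)) :
    segmentPotential L₀ W t = toMat (Γ (A : SymMat n) (projectedVelocity L₀ W t)) := by
  refine Γ_unique A _ _ ?_
  have hs := isSymm_segmentPotential hW hdet
  have h1 := mul_segmentPotential hdet
  have h2 : segmentPotential L₀ W t * (segmentAt L₀ W t).transpose = W.transpose := by
    rw [← h1, Matrix.transpose_mul, hs, h1]
  rw [hA, bundleProj, Matrix.mul_assoc, h1, ← Matrix.mul_assoc, h2]
  rfl

theorem segmentPotential_mul_bundleProj_mul {n : ℕ} {L₀ W : Mat n}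
    (hW : (W * L₀.transpose).IsSymm) {t : ℝ} (hdet : (segmentAt L₀ W t).det ≠ 0) :
    segmentPotential L₀ W t * bundleProj (segmentAt L₀ W t) * segmentPotential L₀ W t
      = bundleProj W := by
  have hs := isSymm_segmentPotential hW hdet
  have h1 := mul_segmentPotential hdet
  have h2 : segmentPotential L₀ W t * (segmentAt L₀ W t).transpose = W.transpose := by
    rw [← h1, Matrix.transpose_mul, hs, h1]
  rw [bundleProj, ← Matrix.mul_assoc, h2, Matrix.mul_assoc, h1, bundleProj]

theorem gW_projectedVelocity {n : ℕ} {L₀ W : Mat n} (hW : (W * L₀.transpose).IsSymm) {t : ℝ}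
    (hdet : (segmentAt L₀ W t).det ≠ 0) (A : SPD n) (hA : mat A = bundleProj (segmentAt L₀ W t)) :
    gW (A : SymMat n) (projectedVelocity L₀ W t) (projectedVelocity L₀ W t)
      = (bundleProj W).trace := by
  rw [gW_apply, ← segmentPotential_eq_Γ hW hdet A hA, ← segmentPotential_mul_bundleProj_mul hW hdet,
    ← hA]
  rfl

/-! ### Curves in `SPD(n)` as curves in `Sym(n)` -/

/-- The chart of an open subset is its inclusion, so the manifold derivative unfolds to the ordinary
one. -/
theorem mfderiv_eq_fderiv_coe {n : ℕ} {γ : ℝ → SPD n} {t : ℝ}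
    (hγ : MDifferentiableAt 𝓘(ℝ, ℝ) 𝓘(ℝ, SymMat n) γ t) :
    (mfderiv 𝓘(ℝ, ℝ) 𝓘(ℝ, SymMat n) γ t : ℝ →L[ℝ] SymMat n)
      = fderiv ℝ (fun s => (γ s : SymMat n)) t := by
  rw [mfderiv]
  refine (if_pos hγ).trans ?_
  rw [modelWithCornersSelf_coe, Set.range_id]
  change fderivWithin ℝ (fun s => (γ s : SymMat n)) Set.univ t = _
  rw [fderivWithin_univ]

theorem enorm_mfderiv_eq {n : ℕ} {γ : ℝ → SPD n} {t : ℝ} {v : SymMat n}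
    (hγ : MDifferentiableAt 𝓘(ℝ, ℝ) 𝓘(ℝ, SymMat n) γ t)
    (hv : HasDerivAt (fun s => (γ s : SymMat n)) v t) :
    ‖mfderiv 𝓘(ℝ, ℝ) 𝓘(ℝ, SymMat n) γ t 1‖ₑ
      = ENNReal.ofReal (Real.sqrt (gW (γ t : SymMat n) v v)) := by
  have h1 : mfderiv 𝓘(ℝ, ℝ) 𝓘(ℝ, SymMat n) γ t 1 = v := by
    refine (congrArg (fun L : ℝ →L[ℝ] SymMat n => L 1) (mfderiv_eq_fderiv_coe hγ)).trans ?_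
    exact hv.deriv
  rw [← ofReal_norm, norm_tangent]
  exact congrArg (fun w : SymMat n => ENNReal.ofReal (Real.sqrt (gW (γ t : SymMat n) w w))) h1

/-! ### The projection of a horizontal segment is a geodesic -/

section Segment

variable {n : ℕ} {L₀ W : Mat n} {γ : ℝ → SPD n}

theorem coe_eqOn_projectedSegment
    (hγ : ∀ t ∈ Set.Icc (0 : ℝ) 1, mat (γ t) = bundleProj (segmentAt L₀ W t)) :
    Set.EqOn (fun t => (γ t : SymMat n)) (projectedSegment L₀ W) (Set.Icc 0 1) :=
  fun t ht => toMat_injective (hγ t ht)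

theorem velocity_eq_projectedVelocity
    (hγ : ∀ t ∈ Set.Icc (0 : ℝ) 1, mat (γ t) = bundleProj (segmentAt L₀ W t)) :
    Set.EqOn (velocity γ) (projectedVelocity L₀ W) (Set.Icc 0 1) := by
  intro t ht
  have h := coe_eqOn_projectedSegment hγ
  rw [velocity, derivWithin_congr h (h ht)]
  exact (hasDerivAt_projectedSegment L₀ W t).hasDerivWithinAt.derivWithin
    (uniqueDiffOn_Icc zero_lt_one t ht)

theorem acceleration_eq
    (hγ : ∀ t ∈ Set.Icc (0 : ℝ) 1, mat (γ t) = bundleProj (segmentAt L₀ W t)) {t : ℝ}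
    (ht : t ∈ Set.Icc (0 : ℝ) 1) :
    acceleration γ t = (2 : ℝ) • ofSymm (bundleProj W) (isSymm_bundleProj W) := by
  have h := velocity_eq_projectedVelocity hγ
  rw [acceleration, derivWithin_congr h (h ht)]
  exact (hasDerivAt_projectedVelocity L₀ W t).hasDerivWithinAt.derivWithin
    (uniqueDiffOn_Icc zero_lt_one t ht)

theorem contMDiffOn_of_eq_bundleProj
    (hγ : ∀ t ∈ Set.Icc (0 : ℝ) 1, mat (γ t) = bundleProj (segmentAt L₀ W t)) :
    ContMDiffOn 𝓘(ℝ, ℝ) 𝓘(ℝ, SymMat n) ∞ γ (Set.Icc 0 1) := by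
  intro t ht
  rw [← ContMDiffWithinAt.subtypeVal_comp_iff]
  have h := coe_eqOn_projectedSegment hγ
  exact ((contDiff_projectedSegment L₀ W).contMDiff.contMDiffAt.contMDiffWithinAt).congr h (h ht)

theorem isGeodesic_of_horizontal_segment (hW : (W * L₀.transpose).IsSymm)
    (hdet : ∀ t ∈ Set.Icc (0 : ℝ) 1, (segmentAt L₀ W t).det ≠ 0)
    (hγ : ∀ t ∈ Set.Icc (0 : ℝ) 1, mat (γ t) = bundleProj (segmentAt L₀ W t)) :
    IsGeodesic γ where
  smooth := contMDiffOn_of_eq_bundleProj hγ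
  equation t ht Z := by
    refine geodesic_equation_of_eq (γ t) _ _ Z ?_
    rw [velocity_eq_projectedVelocity hγ ht, acceleration_eq hγ ht,
      ← segmentPotential_eq_Γ hW (hdet t ht) (γ t) (hγ t ht), hγ t ht,
      segmentPotential_mul_bundleProj_mul hW (hdet t ht)]
    rfl

theorem pathELength_of_horizontal_segment (hW : (W * L₀.transpose).IsSymm)
    (hdet : ∀ t ∈ Set.Icc (0 : ℝ) 1, (segmentAt L₀ W t).det ≠ 0)
    (hγ : ∀ t ∈ Set.Icc (0 : ℝ) 1, mat (γ t) = bundleProj (segmentAt L₀ W t)) :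
    Manifold.pathELength 𝓘(ℝ, SymMat n) γ 0 1
      = ENNReal.ofReal (Real.sqrt (bundleProj W).trace) := by
  -- The curve is prescribed only on `[0, 1]`, so a two-sided derivative is available only in the
  -- interior.
  rw [Manifold.pathELength_eq_lintegral_mfderiv_Ioo]
  have h : Set.EqOn (fun t => ‖mfderiv 𝓘(ℝ, ℝ) 𝓘(ℝ, SymMat n) γ t 1‖ₑ)
      (fun _ => ENNReal.ofReal (Real.sqrt (bundleProj W).trace)) (Set.Ioo 0 1) := by
    intro t ht
    have ht' := Set.Ioo_subset_Icc_self ht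
    have hnhds : Set.Icc (0 : ℝ) 1 ∈ nhds t := Icc_mem_nhds ht.1 ht.2
    have hd : MDifferentiableAt 𝓘(ℝ, ℝ) 𝓘(ℝ, SymMat n) γ t :=
      (((contMDiffOn_of_eq_bundleProj hγ) t ht').contMDiffAt hnhds).mdifferentiableAt (by simp)
    have hv : HasDerivAt (fun s => (γ s : SymMat n)) (projectedVelocity L₀ W t) t :=
      (hasDerivAt_projectedSegment L₀ W t).congr_of_eventuallyEq
        ((coe_eqOn_projectedSegment hγ).eventuallyEq_of_mem hnhds)
    change ‖mfderiv 𝓘(ℝ, ℝ) 𝓘(ℝ, SymMat n) γ t 1‖ₑ = _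
    rw [enorm_mfderiv_eq hd hv, gW_projectedVelocity hW (hdet t ht') (γ t) (hγ t ht')]
  rw [MeasureTheory.setLIntegral_congr_fun measurableSet_Ioo h]
  simp

end Segment

/-! ### Calibration: a lower bound for the length of curves -/

theorem hasDerivAt_segmentAt {n : ℕ} (L₀ W : Mat n) (t : ℝ) :
    HasDerivAt (segmentAt L₀ W) W t := by
  -- An auxiliary norm, used only to make the differentiation rules applicable.
  let _ := Matrix.linftyOpNormedRing (n := Fin n) (α := ℝ)
  let _ := Matrix.linftyOpNormedAlgebra (n := Fin n) (α := ℝ) (R := ℝ)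
  exact (((hasDerivAt_id t).smul_const W).const_add L₀).congr_deriv (one_smul ℝ W)

theorem derivWithin_segmentAt {n : ℕ} (L₀ W : Mat n) {t : ℝ} (ht : t ∈ Set.Icc (0 : ℝ) 1) :
    derivWithin (segmentAt L₀ W) (Set.Icc 0 1) t = W := by
  let _ := Matrix.linftyOpNormedRing (n := Fin n) (α := ℝ)
  let _ := Matrix.linftyOpNormedAlgebra (n := Fin n) (α := ℝ) (R := ℝ)
  exact (hasDerivAt_segmentAt L₀ W t).hasDerivWithinAt.derivWithin
    (uniqueDiffOn_Icc zero_lt_one t ht)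

/-- From `(L⁻¹)' = -L⁻¹ W L⁻¹`, multiplied on the right by `W`, comes the Riccati equation `G' =
-G²`. -/
theorem hasDerivAt_segmentPotential {n : ℕ} {L₀ W : Mat n} {t : ℝ}
    (hdet : (segmentAt L₀ W t).det ≠ 0) :
    HasDerivAt (segmentPotential L₀ W)
      (-(segmentPotential L₀ W t * segmentPotential L₀ W t)) t := by
  let _ := Matrix.linftyOpNormedRing (n := Fin n) (α := ℝ)
  let _ := Matrix.linftyOpNormedAlgebra (n := Fin n) (α := ℝ) (R := ℝ)
  obtain ⟨u, hu⟩ := (Matrix.isUnit_iff_isUnit_det _).2 (isUnit_iff_ne_zero.2 hdet)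
  have h1 := hasFDerivAt_ringInverse (𝕜 := ℝ) u
  rw [hu] at h1
  have h2 := (h1.comp_hasDerivAt t (hasDerivAt_segmentAt L₀ W t)).mul_const W
  have h3 : segmentPotential L₀ W = fun s => Ring.inverse (segmentAt L₀ W s) * W := by
    funext s
    rw [segmentPotential, Matrix.nonsing_inv_eq_ringInverse]
  rw [h3]
  refine h2.congr_deriv ?_
  change _ = -(Ring.inverse (segmentAt L₀ W t) * W * (Ring.inverse (segmentAt L₀ W t) * W))
  rw [← hu, Ring.inverse_unit]
  simp [mul_assoc]

theorem hasDerivAt_trace_mul {n : ℕ} {M N : ℝ → Mat n} {M' N' : Mat n} {t : ℝ}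
    (hM : HasDerivAt M M' t) (hN : HasDerivAt N N' t) :
    HasDerivAt (fun s => (M s * N s).trace) ((M' * N t).trace + (M t * N').trace) t := by
  let _ := Matrix.linftyOpNormedRing (n := Fin n) (α := ℝ)
  let _ := Matrix.linftyOpNormedAlgebra (n := Fin n) (α := ℝ) (R := ℝ)
  rw [← Matrix.trace_add]
  exact (LinearMap.toContinuousLinearMap (Matrix.traceLinearMap (Fin n) ℝ ℝ)).hasFDerivAt
    |>.comp_hasDerivAt t (hM.mul hN)

theorem hasDerivAt_toMat {n : ℕ} {c : ℝ → SymMat n} {c' : SymMat n} {t : ℝ}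
    (hc : HasDerivAt c c' t) : HasDerivAt (fun s => toMat (c s)) (toMat c') t := by
  let _ := Matrix.linftyOpNormedRing (n := Fin n) (α := ℝ)
  let _ := Matrix.linftyOpNormedAlgebra (n := Fin n) (α := ℝ) (R := ℝ)
  exact (LinearMap.toContinuousLinearMap (toMat (n := n))).hasFDerivAt.comp_hasDerivAt t hc

/-- Young's inequality for a potential `Φ` against a tangent vector `X`. -/
theorem trace_mul_le_of_pos {n : ℕ} (A : SPD n) (X : SymMat n) {Φ : Mat n} (hΦ : Φ.IsSymm) {r : ℝ}
    (hr : 0 < r) :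
    (toMat X * Φ).trace - r * (mat A * (Φ * Φ)).trace ≤ gW (A : SymMat n) X X / r := by
  set Y := toMat (Γ (A : SymMat n) X) with hY
  have hYt : Y.transpose = Y := transpose_toMat _
  -- Expanding the nonnegative trace of `(rΦ - Y) A (rΦ - Y)`, where `tr(XΦ) = 2 tr(ΦAY)`, and
  -- dividing by `r` gives the claim.
  have hps : ((r • Φ - Y).conjTranspose * mat A * (r • Φ - Y)).PosSemidef :=
    (mat_posDef A).posSemidef.conjTranspose_mul_mul_same _
  have h0 := hps.trace_nonneg
  have ht : (r • Φ - Y).conjTranspose = r • Φ - Y := by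
    rw [Matrix.conjTranspose_eq_transpose_of_trivial, Matrix.transpose_sub, Matrix.transpose_smul,
      hΦ, hYt]
  have e1 : (toMat X * Φ).trace = 2 * (Φ * mat A * Y).trace := by
    have e2 : (Y * mat A * Φ).trace = (Φ * mat A * Y).trace := by
      rw [← Matrix.trace_transpose, Matrix.transpose_mul, Matrix.transpose_mul, hΦ, hYt,
        transpose_eq_of_posDef (mat_posDef A), Matrix.mul_assoc]
    have e3 : (mat A * Y * Φ).trace = (Φ * mat A * Y).trace := by
      rw [Matrix.trace_mul_comm, Matrix.mul_assoc]
    rw [← sylvester_Γ A X, Matrix.add_mul, Matrix.trace_add, ← hY, e2, e3]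
    ring
  have e2 : (Y * mat A * Φ).trace = (Φ * mat A * Y).trace := by
    rw [← Matrix.trace_transpose, Matrix.transpose_mul, Matrix.transpose_mul, hΦ, hYt,
      transpose_eq_of_posDef (mat_posDef A), Matrix.mul_assoc]
  have e4 : (mat A * (Φ * Φ)).trace = (Φ * mat A * Φ).trace := by
    rw [← Matrix.mul_assoc, Matrix.trace_mul_comm, Matrix.mul_assoc]
  have e5 : gW (A : SymMat n) X X = (Y * mat A * Y).trace := rfl
  rw [ht] at h0
  simp only [Matrix.sub_mul, Matrix.mul_sub, Matrix.trace_sub, Matrix.smul_mul, Matrix.mul_smul,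
    Matrix.trace_smul, smul_eq_mul, e2] at h0
  rw [e1, e4, e5, le_div_iff₀ hr]
  linarith

/-- The calibrating function on the segment itself: it grows by exactly `tr(WᵀW)` over unit time. -/
theorem trace_mul_segmentPotential {n : ℕ} {L₀ W : Mat n} {t : ℝ}
    (hdet : (segmentAt L₀ W t).det ≠ 0) :
    (bundleProj (segmentAt L₀ W t) * segmentPotential L₀ W t).trace
      = (L₀.transpose * W).trace + t * (bundleProj W).trace := by
  rw [bundleProj, Matrix.mul_assoc, mul_segmentPotential hdet, segmentAt, Matrix.transpose_add,
    Matrix.transpose_smul, Matrix.add_mul, Matrix.trace_add, Matrix.smul_mul, Matrix.trace_smul,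
    smul_eq_mul, bundleProj]

/-- Any curve in `SPD(n)` joining the endpoints of the projection of a horizontal segment is at
least as long as the segment. -/
theorem trace_bundleProj_le_sq_integral {n : ℕ} {L₀ W : Mat n} (hW : (W * L₀.transpose).IsSymm)
    (hdet : ∀ t ∈ Set.Icc (0 : ℝ) 1, (segmentAt L₀ W t).det ≠ 0) {c : ℝ → SPD n}
    {c' : ℝ → SymMat n} (hc : ∀ t, HasDerivAt (fun s => (c s : SymMat n)) (c' t) t)
    (hspeed : Continuous fun t => Real.sqrt (gW (c t : SymMat n) (c' t) (c' t)))
    (h0 : mat (c 0) = bundleProj (segmentAt L₀ W 0))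
    (h1 : mat (c 1) = bundleProj (segmentAt L₀ W 1)) :
    (bundleProj W).trace
      ≤ (∫ t in (0 : ℝ)..1, Real.sqrt (gW (c t : SymMat n) (c' t) (c' t))) ^ 2 := by
  set v : ℝ → ℝ := fun t => Real.sqrt (gW (c t : SymMat n) (c' t) (c' t)) with hv
  set S : ℝ → ℝ := fun t => ∫ s in (0 : ℝ)..t, v s with hS
  have hv0 : ∀ t, 0 ≤ v t := fun t => Real.sqrt_nonneg _
  have hv2 : ∀ t, gW (c t : SymMat n) (c' t) (c' t) = v t ^ 2 := fun t => by
    refine (Real.sq_sqrt ?_).symm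
    by_cases h : c' t = 0
    · simp [h]
    · exact (gW_pos (c t) _ h).le
  have hSd : ∀ t, HasDerivAt S (v t) t := fun t => hspeed.integral_hasStrictDerivAt 0 t |>.hasDerivAt
  have hSmono : Monotone S := monotone_of_hasDerivAt_nonneg hSd hv0
  have hS0 : S 0 = 0 := intervalIntegral.integral_same
  have hS1 : 0 ≤ S 1 := hS0 ▸ hSmono zero_le_one
  -- The parameter `ε` keeps the rate of the change of time positive where `c` stands still; it is
  -- removed by a limit.
  suffices h : ∀ ε > 0, (bundleProj W).trace ≤ (S 1 + ε) * S 1 by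
    have hlim : Filter.Tendsto (fun ε : ℝ => (S 1 + ε) * S 1) (nhdsWithin 0 (Set.Ioi 0))
        (nhds ((S 1 + 0) * S 1)) :=
      Filter.Tendsto.mono_left (Continuous.tendsto (by fun_prop) 0) nhdsWithin_le_nhds
    have := ge_of_tendsto hlim (Filter.eventually_of_mem self_mem_nhdsWithin fun ε hε => h ε hε)
    rw [sq]
    simpa using this
  intro ε hε
  have hpos : 0 < S 1 + ε := by linarith
  -- the potential, reparametrized proportionally to the (regularized) arc length of `c`
  set σ : ℝ → ℝ := fun t => (S t + t * ε) / (S 1 + ε) with hσ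
  have hσd : ∀ t, HasDerivAt σ ((v t + ε) / (S 1 + ε)) t := fun t => by
    have := ((hSd t).add ((hasDerivAt_id t).mul_const ε)).div_const (S 1 + ε)
    simpa using! this
  have hσ0 : σ 0 = 0 := by simp [hσ, hS0]
  have hσ1 : σ 1 = 1 := by simp [hσ, hpos.ne']
  have hσmono : Monotone σ := monotone_of_hasDerivAt_nonneg hσd fun t =>
    div_nonneg (add_nonneg (hv0 t) hε.le) hpos.le
  have hσmem : ∀ t ∈ Set.Icc (0 : ℝ) 1, σ t ∈ Set.Icc (0 : ℝ) 1 := fun t ht =>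
    ⟨hσ0 ▸ hσmono ht.1, hσ1 ▸ hσmono ht.2⟩
  set F : ℝ → ℝ := fun t => (mat (c t) * segmentPotential L₀ W (σ t)).trace with hF
  have hFd : ∀ t ∈ Set.Icc (0 : ℝ) 1, HasDerivAt F
      ((toMat (c' t) * segmentPotential L₀ W (σ t)).trace
        - (v t + ε) / (S 1 + ε) * (mat (c t) *
          (segmentPotential L₀ W (σ t) * segmentPotential L₀ W (σ t))).trace) t := fun t ht => by
    let _ := Matrix.linftyOpNormedRing (n := Fin n) (α := ℝ)
    let _ := Matrix.linftyOpNormedAlgebra (n := Fin n) (α := ℝ) (R := ℝ)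
    have hΦ := (hasDerivAt_segmentPotential (hdet _ (hσmem t ht))).scomp t (hσd t)
    refine (hasDerivAt_trace_mul (hasDerivAt_toMat (hc t)) hΦ).congr_deriv ?_
    rw [smul_neg, Matrix.mul_neg, Matrix.trace_neg, Matrix.mul_smul, Matrix.trace_smul,
      smul_eq_mul, ← sub_eq_add_neg]
    rfl
  have hGd : ∀ t ∈ Set.Icc (0 : ℝ) 1, HasDerivAt (fun s => F s - (S 1 + ε) * S s) _ t :=
    fun t ht => (hFd t ht).sub ((hSd t).const_mul (S 1 + ε))
  -- Young's inequality with `r = σ'` gives `F' ≤ v²/σ' = (S 1 + ε) v²/(v + ε) ≤ (S 1 + ε) v`, the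
  -- derivative of `(S 1 + ε) S`.
  have hanti : AntitoneOn (fun s => F s - (S 1 + ε) * S s) (Set.Icc 0 1) := by
    refine antitoneOn_of_deriv_nonpos (convex_Icc 0 1)
      (fun t ht => (hGd t ht).continuousAt.continuousWithinAt)
      (fun t ht => (hGd t (interior_subset ht)).differentiableAt.differentiableWithinAt)
      fun t ht => ?_
    rw [(hGd t (interior_subset ht)).deriv]
    have hvε : 0 < v t + ε := add_pos_of_nonneg_of_pos (hv0 t) hε
    have hr : 0 < (v t + ε) / (S 1 + ε) := div_pos hvε hpos
    have h2 := trace_mul_le_of_pos (c t) (c' t)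
      (isSymm_segmentPotential hW (hdet _ (hσmem t (interior_subset ht)))) hr
    have h3 : gW (c t : SymMat n) (c' t) (c' t) / ((v t + ε) / (S 1 + ε)) ≤ (S 1 + ε) * v t := by
      rw [hv2, div_div_eq_mul_div, div_le_iff₀ hvε]
      nlinarith [mul_nonneg (mul_nonneg hpos.le (hv0 t)) hε.le]
    linarith
  have h2 := hanti (Set.left_mem_Icc.2 zero_le_one) (Set.right_mem_Icc.2 zero_le_one) zero_le_one
  have hF0 : F 0 = (L₀.transpose * W).trace := by
    simp only [hF]
    rw [hσ0, h0, trace_mul_segmentPotential (hdet 0 (Set.left_mem_Icc.2 zero_le_one)), zero_mul,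
      add_zero]
  have hF1 : F 1 = (L₀.transpose * W).trace + (bundleProj W).trace := by
    simp only [hF]
    rw [hσ1, h1, trace_mul_segmentPotential (hdet 1 (Set.right_mem_Icc.2 zero_le_one)), one_mul]
  simp only [hF0, hF1, hS0] at h2
  linarith

/-! ### The projection of a horizontal segment is a minimal geodesic -/

theorem pathELength_eq_ofReal_integral {n : ℕ} {c : ℝ → SPD n} {c' : ℝ → SymMat n}
    (hc : ContMDiff 𝓘(ℝ, ℝ) 𝓘(ℝ, SymMat n) 1 c)
    (hc' : ∀ t, HasDerivAt (fun s => (c s : SymMat n)) (c' t) t)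
    (hspeed : Continuous fun t => Real.sqrt (gW (c t : SymMat n) (c' t) (c' t))) :
    Manifold.pathELength 𝓘(ℝ, SymMat n) c 0 1
      = ENNReal.ofReal (∫ t in (0 : ℝ)..1, Real.sqrt (gW (c t : SymMat n) (c' t) (c' t))) := by
  rw [Manifold.pathELength_eq_lintegral_mfderiv_Icc,
    intervalIntegral.integral_of_le zero_le_one, ← MeasureTheory.integral_Icc_eq_integral_Ioc,
    MeasureTheory.ofReal_integral_eq_lintegral_ofReal hspeed.integrableOn_Icc
      (Filter.Eventually.of_forall fun _ => Real.sqrt_nonneg _)]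
  refine MeasureTheory.lintegral_congr fun t => ?_
  exact enorm_mfderiv_eq ((hc t).mdifferentiableAt one_ne_zero) (hc' t)

theorem continuous_speed {n : ℕ} {c : ℝ → SPD n} (hc : ContDiff ℝ 1 fun s => (c s : SymMat n)) :
    Continuous fun t => Real.sqrt (gW (c t : SymMat n) (deriv (fun s => (c s : SymMat n)) t)
      (deriv (fun s => (c s : SymMat n)) t)) := by
  have h1 : Continuous (deriv fun s => (c s : SymMat n)) := hc.continuous_deriv le_rfl
  have h2 : Continuous fun t => gW (c t : SymMat n) :=
    (contDiffOn_gW n).continuousOn.comp_continuous hc.continuous fun t => (c t).2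
  exact Real.continuous_sqrt.comp ((h2.clm_apply h1).clm_apply h1)

theorem isMinimalGeodesic_of_horizontal_segment {n : ℕ} {L₀ W : Mat n} {γ : ℝ → SPD n}
    (hW : (W * L₀.transpose).IsSymm)
    (hdet : ∀ t ∈ Set.Icc (0 : ℝ) 1, (segmentAt L₀ W t).det ≠ 0)
    (hγ : ∀ t ∈ Set.Icc (0 : ℝ) 1, mat (γ t) = bundleProj (segmentAt L₀ W t)) :
    IsMinimalGeodesic (γ 0) (γ 1) γ where
  source := rfl
  target := rfl
  isGeodesic := isGeodesic_of_horizontal_segment hW hdet hγ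
  length_eq := by
    refine le_antisymm ?_ (Manifold.riemannianEDist_le_pathELength
      ((contMDiffOn_of_eq_bundleProj hγ).of_le (by simp)) rfl rfl zero_le_one)
    refine le_of_forall_gt fun r hr => ?_
    -- The competitor can be taken `C^1` on the whole real line, so that it is differentiable at the
    -- endpoints too.
    obtain ⟨c, hc0, hc1, hc, hlt, -⟩ :=
      Manifold.exists_lt_locally_constant_of_riemannianEDist_lt hr zero_lt_one
    refine lt_of_le_of_lt ?_ hlt
    have hc' : ContDiff ℝ 1 fun s => (c s : SymMat n) :=
      (contMDiff_subtype_val.comp hc).contDiff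
    have hd : ∀ t, HasDerivAt (fun s => (c s : SymMat n)) (deriv (fun s => (c s : SymMat n)) t) t :=
      fun t => (hc'.differentiable one_ne_zero t).hasDerivAt
    rw [pathELength_of_horizontal_segment hW hdet hγ,
      pathELength_eq_ofReal_integral hc hd (continuous_speed hc')]
    refine ENNReal.ofReal_le_ofReal (Real.sqrt_le_iff.2 ⟨?_, ?_⟩)
    · exact intervalIntegral.integral_nonneg zero_le_one fun _ _ => Real.sqrt_nonneg _
    · refine trace_bundleProj_le_sq_integral hW hdet hd (continuous_speed hc') ?_ ?_
      · rw [hc0, hγ 0 (Set.left_mem_Icc.2 zero_le_one)]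
      · rw [hc1, hγ 1 (Set.right_mem_Icc.2 zero_le_one)]

/-! ### The explicit segment -/

theorem det_combination_pos {n : ℕ} {P Q : Mat n} (hP : P.PosDef) (hQ : Q.PosDef) {t : ℝ}
    (ht : t ∈ Set.Icc (0 : ℝ) 1) : 0 < (t • (Q * P⁻¹) + (1 - t) • P).det := by
  have hu := (Matrix.isUnit_iff_isUnit_det _).1 hP.isUnit
  have hPP : (P * P).PosDef := by
    have := Matrix.PosDef.conjTranspose_mul_self P (Matrix.mulVec_injective_iff_isUnit.2 hP.isUnit)
    rwa [show P.conjTranspose = P from hP.isHermitian] at this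
  have hR : (t • Q + (1 - t) • (P * P)).PosDef := by
    -- At `t = 0` the term in `Q` vanishes and definiteness comes from `P²`; otherwise it comes from
    -- `tQ`.
    rcases ht.1.eq_or_lt with rfl | h0
    · simpa using hPP
    · exact (hQ.smul h0).add_posSemidef (hPP.posSemidef.smul (sub_nonneg.2 ht.2))
  have h : t • (Q * P⁻¹) + (1 - t) • P = (t • Q + (1 - t) • (P * P)) * P⁻¹ := by
    rw [Matrix.add_mul, Matrix.smul_mul, Matrix.smul_mul, Matrix.mul_nonsing_inv_cancel_right _ _ hu]
  rw [h, Matrix.det_mul]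
  exact mul_pos hR.det_pos hP.inv.det_pos

theorem bundleProj_combination {n : ℕ} {P Q : Mat n} (hP : P.PosDef) (hQ : Q.PosDef) (t : ℝ) :
    bundleProj (t • (Q * P⁻¹) + (1 - t) • P)
      = (1 - t) ^ 2 • (P * P) + (t * (1 - t)) • (P * Q * P⁻¹ + P⁻¹ * Q * P)
        + t ^ 2 • (P⁻¹ * (Q * Q) * P⁻¹) := by
  have hPt := transpose_eq_of_posDef hP
  have hQt := transpose_eq_of_posDef hQ
  simp only [bundleProj, Matrix.transpose_add, Matrix.transpose_smul, Matrix.transpose_mul,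
    Matrix.transpose_nonsing_inv, hPt, hQt, Matrix.add_mul, Matrix.mul_add, Matrix.smul_mul,
    Matrix.mul_smul, Matrix.mul_assoc]
  module

theorem existsUnique_isPrincipalSqrt {n : ℕ} {M S : Mat n} (hS : IsPrincipalSqrt M S) :
    ∃! S, IsPrincipalSqrt M S :=
  ⟨S, hS, fun _ hT => hT.unique hS⟩

theorem explicit_geodesic {n : ℕ} (A₁ A₂ : SPD n) :
      (∃! S, IsPrincipalSqrt (mat A₁ * mat A₂) S) ∧
      (∃! S, IsPrincipalSqrt (mat A₁) S) ∧
      (principalSqrt (mat A₁)).PosDef ∧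
      (∃ γ : ℝ → SPD n,
        (∀ t ∈ Set.Icc (0 : ℝ) 1, mat (γ t) = wassersteinCurve (mat A₁) (mat A₂) t) ∧
        IsMinimalGeodesic A₁ A₂ γ) ∧
      bundleProj (principalSqrt (mat A₁)) = mat A₁ ∧
      bundleProj (liftTarget (mat A₁) (mat A₂)) = mat A₂ ∧
      (∀ t ∈ Set.Icc (0 : ℝ) 1, 0 < (liftSegment (mat A₁) (mat A₂) t).det) ∧
      IsLevel (liftSegment (mat A₁) (mat A₂)) ∧
      (∀ t ∈ Set.Icc (0 : ℝ) 1,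
        bundleProj (liftSegment (mat A₁) (mat A₂) t)
          = wassersteinCurve (mat A₁) (mat A₂) t) := by
  obtain ⟨P, Q, hP, hQ, hA₁, hA₂⟩ := exists_square_roots (mat_posDef A₁) (mat_posDef A₂)
  have hPt := transpose_eq_of_posDef hP
  have hQt := transpose_eq_of_posDef hQ
  have hu := (Matrix.isUnit_iff_isUnit_det _).1 hP.isUnit
  have hs₁ : IsPrincipalSqrt (mat A₁) P := hA₁ ▸ isPrincipalSqrt_of_posDef hP
  have hs₁₂ : IsPrincipalSqrt (mat A₁ * mat A₂) (P * Q * P⁻¹) := by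
    convert isPrincipalSqrt_conj hP.isUnit hQ using 1
    rw [← hA₁, ← hA₂]
    simp only [Matrix.mul_assoc, Matrix.mul_nonsing_inv_cancel_left _ _ hu]
  -- `A₂A₁` is the transpose of `A₁A₂`, and transposition preserves principal roots.
  have hs₂₁ : IsPrincipalSqrt (mat A₂ * mat A₁) (P⁻¹ * Q * P) := by
    have h := hs₁₂.transpose
    simpa only [Matrix.transpose_mul, Matrix.transpose_nonsing_inv, hPt, hQt,
      transpose_eq_of_posDef (mat_posDef A₁), transpose_eq_of_posDef (mat_posDef A₂),
      ← Matrix.mul_assoc] using h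
  have hlt : liftTarget (mat A₁) (mat A₂) = Q * P⁻¹ := by
    rw [liftTarget, principalSqrt_eq hs₁, principalSqrt_eq hs₁₂, Matrix.mul_assoc,
      Matrix.nonsing_inv_mul_cancel_left _ _ hu]
  have hls : ∀ t, liftSegment (mat A₁) (mat A₂) t = t • (Q * P⁻¹) + (1 - t) • P := fun t => by
    rw [liftSegment, hlt, principalSqrt_eq hs₁]
  have hseg : liftSegment (mat A₁) (mat A₂) = segmentAt P (Q * P⁻¹ - P) := by
    funext t
    rw [hls, segmentAt]
    module
  have hdet : ∀ t ∈ Set.Icc (0 : ℝ) 1, 0 < (liftSegment (mat A₁) (mat A₂) t).det :=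
    fun t ht => hls t ▸ det_combination_pos hP hQ ht
  have hdet' : ∀ t ∈ Set.Icc (0 : ℝ) 1, (segmentAt P (Q * P⁻¹ - P) t).det ≠ 0 :=
    fun t ht => hseg ▸ (hdet t ht).ne'
  have hproj : ∀ t, bundleProj (liftSegment (mat A₁) (mat A₂) t)
      = wassersteinCurve (mat A₁) (mat A₂) t := fun t => by
    rw [hls, bundleProj_combination hP hQ, hA₁, hA₂, wassersteinCurve, principalSqrt_eq hs₁₂,
      principalSqrt_eq hs₂₁]
  -- The product is `Q - P²`, a difference of symmetric matrices.
  have hW : ((Q * P⁻¹ - P) * P.transpose).IsSymm := by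
    rw [hPt, Matrix.sub_mul, Matrix.nonsing_inv_mul_cancel_right _ _ hu, Matrix.IsSymm,
      Matrix.transpose_sub, Matrix.transpose_mul, hPt, hQt]
  refine ⟨existsUnique_isPrincipalSqrt hs₁₂, existsUnique_isPrincipalSqrt hs₁,
    (principalSqrt_eq hs₁).symm ▸ hP, ?_, ?_, ?_, hdet, ?_, fun t _ => hproj t⟩
  · have hpd : ∀ t : Set.Icc (0 : ℝ) 1,
        (bundleProj (segmentAt P (Q * P⁻¹ - P) t)).PosDef :=
      fun t => posDef_bundleProj (hdet' t t.2)
    -- Time is clamped to `[0, 1]`, since the formula need not be positive definite outside it.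
    let γ : ℝ → SPD n := fun t =>
      ⟨projectedSegment P (Q * P⁻¹ - P) (Set.projIcc (0 : ℝ) 1 zero_le_one t), hpd _⟩
    have hγ : ∀ t ∈ Set.Icc (0 : ℝ) 1,
        mat (γ t) = bundleProj (segmentAt P (Q * P⁻¹ - P) t) := fun t ht => by
      change bundleProj (segmentAt P (Q * P⁻¹ - P) (Set.projIcc (0 : ℝ) 1 zero_le_one t)) = _
      rw [Set.projIcc_of_mem _ ht]
    have hγ' : ∀ t ∈ Set.Icc (0 : ℝ) 1, mat (γ t) = wassersteinCurve (mat A₁) (mat A₂) t :=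
      fun t ht => by rw [hγ t ht, ← hseg, hproj]
    have hγ0 : γ 0 = A₁ := Subtype.ext <| toMat_injective <|
      (hγ' 0 (Set.left_mem_Icc.2 zero_le_one)).trans (by simp [wassersteinCurve, mat])
    have hγ1 : γ 1 = A₂ := Subtype.ext <| toMat_injective <|
      (hγ' 1 (Set.right_mem_Icc.2 zero_le_one)).trans (by simp [wassersteinCurve, mat])
    have hmin := isMinimalGeodesic_of_horizontal_segment hW hdet' hγ
    rw [hγ0, hγ1] at hmin
    exact ⟨γ, hγ', hmin⟩
  · rw [principalSqrt_eq hs₁, bundleProj, hPt, hA₁]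
  · rw [hlt, bundleProj, Matrix.transpose_mul, Matrix.transpose_nonsing_inv, hPt, hQt, ← hA₂]
    simp only [Matrix.mul_assoc]
  · intro t ht
    rw [hseg, derivWithin_segmentAt P (Q * P⁻¹ - P) ht]
    exact isHorizontal_of_isSymm (hdet' t ht) (isSymm_mul_segmentAt_transpose hW t)

theorem geodesicallyConvex (n : ℕ) : GeodesicallyConvex n := fun A₁ A₂ =>
  let ⟨γ, _, hγ⟩ := (explicit_geodesic A₁ A₂).2.2.2.1
  ⟨γ, hγ⟩

end BuresWasserstein

theorem mainTheorem1 (n : ℕ) :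
    GeodesicallyConvex n ∧
    ∀ A₁ A₂ : SPD n,
      -- the square roots in the formulas are well defined
      (∃! S, IsPrincipalSqrt (mat A₁ * mat A₂) S) ∧
      (∃! S, IsPrincipalSqrt (mat A₁) S) ∧
      (principalSqrt (mat A₁)).PosDef ∧
      -- the explicit curve stays in `SPD(n)` and is a minimal geodesic
      (∃ γ : ℝ → SPD n,
        (∀ t ∈ Set.Icc (0 : ℝ) 1, mat (γ t) = wassersteinCurve (mat A₁) (mat A₂) t) ∧
        IsMinimalGeodesic A₁ A₂ γ) ∧
      -- the endpoints of the segment are lifts of `A₁` and `A₂`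
      bundleProj (principalSqrt (mat A₁)) = mat A₁ ∧
      bundleProj (liftTarget (mat A₁) (mat A₂)) = mat A₂ ∧
      -- the segment is non-degenerate, level, and projects to the explicit curve
      (∀ t ∈ Set.Icc (0 : ℝ) 1, 0 < (liftSegment (mat A₁) (mat A₂) t).det) ∧
      IsLevel (liftSegment (mat A₁) (mat A₂)) ∧
      (∀ t ∈ Set.Icc (0 : ℝ) 1,
        bundleProj (liftSegment (mat A₁) (mat A₂) t)
          = wassersteinCurve (mat A₁) (mat A₂) t) := by
  exact ⟨geodesicallyConvex n, explicit_geodesic⟩
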